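/- Let $n\ge 1$, $p\ge 0$ and $\overline\tau\ge 0$ be integers. Let $C=(C_{ij})\in\mathbb R^{n\times n}$ be an irreducible, column-stochastic matrix with nonnegative entries, where $C_{ij}$ is the weight of the link $j\to i$ of a directed network ($C_{ij}=0$ if there is no such link; irreducibility means that the network is strongly connected). Every link $j\to i$ carries a fixed integer delay $\tau_{ij}$ with $0\le\tau_{ij}\le\overline\tau$. Assume that at least one agent $\ell$ uses its own current value, that is, $C_{\ell\ell}>0$ and $\tau_{\ell\ell}=0$ for some $\ell$ (this holds in particular if $C$ has a positive diagonal and no agent delays its own data). For $0\le r\le\overline\tau$ let $C_r$ be the $n\times n$ matrix with entries $C_{r,ij}=C_{ij}$ if $\tau_{ij}=r$ and $C_{r,ij}=0$ otherwise, and let $\overline C$ be the augmented matrix of size $n(\overline\tau+1)$, $$\overline C=\begin{pmatrix} C_0 & I_n & 0 & \cdots & 0\\ C_1 & 0 & I_n & \cdots & 0\\ \vdots & \vdots & & \ddots & \vdots\\ C_{\overline\tau-1} & 0 & 0 & \cdots & I_n\\ C_{\overline\tau} & 0 & 0 & \cdots & 0\end{pmatrix}$$ (so $\overline C=C_0$ if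 $\overline\tau=0$). Let $\widehat{\mathbf y}_0\in\mathbb R^{np(\overline\tau+1)}$ be a vector whose first $np$ entries are all equal to $1$, the others being arbitrary, and let $\widehat{\mathbf y}_{k+1}=(\overline C\otimes I_p)\,\widehat{\mathbf y}_k$ and $\mathbf Y_k=\operatorname{diag}(\widehat{\mathbf y}_k)$ for $k\ge 0$. Then the limit $\mathbf Y_\infty=\lim_{k\to\infty}\mathbf Y_k$ exists, and there are constants $0<\gamma_1<1$ and $0<T<\infty$ such that, in the spectral norm, $$\|\mathbf Y_k-\mathbf Y_\infty\|_2\le T\,\gamma_1^{\,k}\qquad\text{for all } k\ge 0 .$$ -/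

import Mathlib

open Filter Topology
open scoped Matrix Kronecker Matrix.Norms.L2Operator

/-- The matrix `C_r` of the weights of the links with delay exactly `r`:
`(C_r) i j = C i j` if `τ i j = r`, and `0` otherwise. Here `C i j` is the weight and `τ i j` the
delay of the link from agent `j` to agent `i`. -/
def delaySlice {n : ℕ} (C : Matrix (Fin n) (Fin n) ℝ) (τ : Fin n → Fin n → ℕ) (r : ℕ) :
    Matrix (Fin n) (Fin n) ℝ :=
  Matrix.of fun i j => if τ i j = r then C i j else 0

/-- The augmented consensus matrix, of size `n (τbar + 1)`, in blocks of size `n`: the first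
block column is `C_0, C_1, …, C_τbar` from top to bottom, the blocks on the first block
superdiagonal are the identity, and all other blocks are zero. The pair `(r, i)` is row `i` of
block row `r`. -/
def augmentedMatrix {n : ℕ} (C : Matrix (Fin n) (Fin n) ℝ) (τ : Fin n → Fin n → ℕ) (τbar : ℕ) :
    Matrix (Fin (τbar + 1) × Fin n) (Fin (τbar + 1) × Fin n) ℝ :=
  Matrix.of fun a b =>
    if (b.1 : ℕ) = 0 then delaySlice C τ a.1 a.2 b.2
    else if (b.1 : ℕ) = a.1 + 1 then (1 : Matrix (Fin n) (Fin n) ℝ) a.2 b.2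
    else 0

/-- The augmented iterates `ŷ_{k+1} = (Cbar ⊗ I_p) ŷ_k` started at `ŷ_0 = y₀`, where `Cbar` is the
augmented consensus matrix. -/
def augmentedY {n : ℕ} (C : Matrix (Fin n) (Fin n) ℝ) (τ : Fin n → Fin n → ℕ) (τbar p : ℕ)
    (y₀ : (Fin (τbar + 1) × Fin n) × Fin p → ℝ) :
    ℕ → (Fin (τbar + 1) × Fin n) × Fin p → ℝ
  | 0 => y₀
  | k + 1 => (augmentedMatrix C τ τbar ⊗ₖ (1 : Matrix (Fin p) (Fin p) ℝ)) *ᵥ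
      augmentedY C τ τbar p y₀ k

/-- The diagonal matrix `Y_k = diag(ŷ_k)`. -/
def diagY {n : ℕ} (C : Matrix (Fin n) (Fin n) ℝ) (τ : Fin n → Fin n → ℕ) (τbar p : ℕ)
    (y₀ : (Fin (τbar + 1) × Fin n) × Fin p → ℝ) (k : ℕ) :
    Matrix ((Fin (τbar + 1) × Fin n) × Fin p) ((Fin (τbar + 1) × Fin n) × Fin p) ℝ :=
  Matrix.diagonal (augmentedY C τ τbar p y₀ k)

open Matrix Finset

/-! The augmented matrix `A` is column-stochastic. In its graph every node leads to `(0, l)`, which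
has a self-loop; waiting on the loop equalizes path lengths, so some power of `A` has a positive row
(`exists_pow_row_pos`). By Doeblin's argument that power contracts the `ℓ¹` norm on vectors of sum
zero (`sum_abs_mulVec_le_of_row_ge`). The increments `A ^ k (A y - y)` are such vectors, so they
decay geometrically, which gives the limit and the rate together, without a Perron vector. -/

section ColStochastic

variable {ι : Type*} [Fintype ι] [DecidableEq ι]

/-- A column-stochastic matrix does not increase the `ℓ¹` norm. -/
theorem sum_abs_mulVec_le {A : Matrix ι ι ℝ} (hA : A ∈ colStochastic ℝ ι) (v : ι → ℝ) :
    ∑ i, |(A *ᵥ v) i| ≤ ∑ i, |v i| := by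
  rw [← sum_mulVec_of_mem_colStochastic hA (x := fun i => |v i|)]
  refine Finset.sum_le_sum fun i _ => ?_
  refine (Finset.abs_sum_le_sum_abs _ _).trans (Finset.sum_le_sum fun b _ => ?_)
  rw [abs_mul, abs_of_nonneg (nonneg_of_mem_colStochastic hA)]

/-- A column-stochastic matrix with a row bounded below by `δ` contracts the `ℓ¹` norm of vectors
of sum zero by the factor `1 - δ`. -/
theorem sum_abs_mulVec_le_of_row_ge {A : Matrix ι ι ℝ} (hA : A ∈ colStochastic ℝ ι) {i₀ : ι}
    {δ : ℝ} (hδ : ∀ b, δ ≤ A i₀ b) {v : ι → ℝ} (hv : ∑ i, v i = 0) :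
    ∑ i, |(A *ᵥ v) i| ≤ (1 - δ) * ∑ i, |v i| := by
  have hent : ∀ i b, 0 ≤ A i b - (if i = i₀ then δ else 0) := by
    intro i b
    split_ifs with h
    · subst h
      exact sub_nonneg.2 (hδ b)
    · simpa using nonneg_of_mem_colStochastic hA
  -- As `v` has sum zero, subtracting the constant `δ` from row `i₀` leaves `A *ᵥ v` unchanged.
  have hrow : ∀ i, (A *ᵥ v) i = ∑ b, (A i b - (if i = i₀ then δ else 0)) * v b := by
    intro i
    simp only [sub_mul, Finset.sum_sub_distrib, ← Finset.mul_sum, hv, mul_zero, sub_zero]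
    rfl
  calc ∑ i, |(A *ᵥ v) i|
      ≤ ∑ i, ∑ b, (A i b - (if i = i₀ then δ else 0)) * |v b| := by
        refine Finset.sum_le_sum fun i _ => ?_
        rw [hrow]
        refine (Finset.abs_sum_le_sum_abs _ _).trans (Finset.sum_le_sum fun b _ => ?_)
        rw [abs_mul, abs_of_nonneg (hent i b)]
    _ = (1 - δ) * ∑ i, |v i| := by
        rw [Finset.sum_comm, Finset.mul_sum]
        refine Finset.sum_congr rfl fun b _ => ?_
        rw [← Finset.sum_mul, Finset.sum_sub_distrib, sum_col_of_mem_colStochastic hA b]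
        simp

/-- A nonnegative, nonincreasing sequence that shrinks by a fixed factor over every `N` steps
decays geometrically, at a rate that depends only on `N` and the factor. -/
theorem exists_geometric_bound_of_contraction {N : ℕ} {δ : ℝ} (hδ : 0 < δ) :
    ∃ γ : ℝ, 0 < γ ∧ γ < 1 ∧ ∀ f : ℕ → ℝ, (∀ k, 0 ≤ f k) → Antitone f →
      (∀ k, f (k + N) ≤ (1 - δ) * f k) → ∃ D : ℝ, 0 ≤ D ∧ ∀ k, f k ≤ D * γ ^ k := by
  -- Chosen for Bernoulli's inequality. The cap `1 / 2` keeps `1 - ε` positive for large `δ`; `N +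
  -- 1` covers `N = 0`.
  set ε : ℝ := min δ (1 / 2) / (N + 1) with hε
  have hm : 0 < min δ (1 / 2) := lt_min hδ (by norm_num)
  have hN : (0 : ℝ) < N + 1 := by positivity
  have hε0 : 0 < ε := by positivity
  have hε1 : ε ≤ 1 / 2 :=
    (div_le_self hm.le (by linarith [Nat.cast_nonneg (α := ℝ) N])).trans (min_le_right _ _)
  have hpow : 1 - δ ≤ (1 - ε) ^ (N + 1) := by
    have h := one_add_mul_le_pow (a := -ε) (by linarith) (N + 1)
    have hmul : ((N + 1 : ℕ) : ℝ) * ε = min δ (1 / 2) := by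
      rw [hε]
      push_cast
      field_simp
    rw [mul_neg, hmul] at h
    calc 1 - δ ≤ 1 + -min δ (1 / 2) := by linarith [min_le_left δ (1 / 2)]
      _ ≤ _ := by rwa [sub_eq_add_neg]
  have hγ0 : 0 < 1 - ε := by linarith
  refine ⟨1 - ε, hγ0, by linarith, fun f hf0 hf hfN => ?_⟩
  have hstep : ∀ k, f (k + (N + 1)) ≤ (1 - ε) ^ (N + 1) * f k := fun k =>
    ((hf (by omega)).trans (hfN k)).trans (mul_le_mul_of_nonneg_right hpow (hf0 k))
  refine ⟨f 0 / (1 - ε) ^ (N + 1), div_nonneg (hf0 0) (by positivity), fun k => ?_⟩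
  induction k using Nat.strong_induction_on with
  | _ k ih =>
    rcases lt_or_ge k (N + 1) with hk | hk
    · rw [div_mul_eq_mul_div, le_div_iff₀ (by positivity)]
      exact mul_le_mul (hf k.zero_le)
        (pow_le_pow_of_le_one hγ0.le (by linarith) hk.le) (by positivity) (hf0 0)
    · obtain ⟨m, rfl⟩ := Nat.exists_eq_add_of_le' hk
      calc f (m + (N + 1)) ≤ (1 - ε) ^ (N + 1) * f m := hstep m
        _ ≤ (1 - ε) ^ (N + 1) * (f 0 / (1 - ε) ^ (N + 1) * (1 - ε) ^ m) := by
            gcongr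
            exact ih m (by omega)
        _ = _ := by rw [pow_add]; ring

/-- If some power of a column-stochastic matrix has a positive row, the increments of its orbits
decay geometrically, at a common rate. -/
theorem exists_geometric_bound_pow_mulVec {A : Matrix ι ι ℝ} (hA : A ∈ colStochastic ℝ ι)
    {i₀ : ι} {N : ℕ} (hpos : ∀ b, 0 < (A ^ N) i₀ b) :
    ∃ γ : ℝ, 0 < γ ∧ γ < 1 ∧ ∀ v : ι → ℝ, ∑ i, v i = 0 →
      ∃ D : ℝ, 0 ≤ D ∧ ∀ k i, |((A ^ k) *ᵥ v) i| ≤ D * γ ^ k := by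
  obtain ⟨b₀, -, hb₀⟩ := Finset.exists_min_image Finset.univ (fun b => (A ^ N) i₀ b)
    ⟨i₀, Finset.mem_univ _⟩
  obtain ⟨γ, hγ0, hγ1, hγ⟩ := exists_geometric_bound_of_contraction (N := N) (hpos b₀)
  refine ⟨γ, hγ0, hγ1, fun v hv => ?_⟩
  have hsum : ∀ k, ∑ i, ((A ^ k) *ᵥ v) i = 0 := fun k => by
    rw [sum_mulVec_of_mem_colStochastic (pow_mem hA k), hv]
  obtain ⟨D, hD0, hD⟩ := hγ (fun k => ∑ i, |((A ^ k) *ᵥ v) i|)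
    (fun k => Finset.sum_nonneg fun i _ => abs_nonneg _)
    (antitone_nat_of_succ_le fun k => by
      rw [pow_succ', ← mulVec_mulVec]
      exact sum_abs_mulVec_le hA _)
    (fun k => by
      rw [add_comm, pow_add, ← mulVec_mulVec]
      exact sum_abs_mulVec_le_of_row_ge (pow_mem hA N) (fun b => hb₀ b (Finset.mem_univ _))
        (hsum k))
  exact ⟨D, hD0, fun k i => (Finset.single_le_sum (f := fun i => |((A ^ k) *ᵥ v) i|)
    (fun i _ => abs_nonneg _) (Finset.mem_univ i)).trans (hD k)⟩

/-- If the diagonal entry at `i₀` of a nonnegative matrix is positive and `i₀` can be reached from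
every index along positive entries, then some power has a positive row at `i₀`. -/
theorem exists_pow_row_pos {A : Matrix ι ι ℝ} (hA : ∀ i j, 0 ≤ A i j) {i₀ : ι}
    (hself : 0 < A i₀ i₀)
    (hreach : ∀ b, Relation.ReflTransGen (fun b a => 0 < A a b) b i₀) :
    ∃ N : ℕ, ∀ b, 0 < (A ^ N) i₀ b := by
  have hmul : ∀ (k : ℕ) (a b c : ι), 0 < (A ^ k) a b → 0 < A b c → 0 < (A ^ (k + 1)) a c := by
    intro k a b c h₁ h₂
    rw [pow_succ, mul_apply]
    exact Finset.sum_pos' (fun j _ => mul_nonneg (pow_apply_nonneg hA k a j) (hA j c))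
      ⟨b, Finset.mem_univ _, mul_pos h₁ h₂⟩
  have hmul' : ∀ (k : ℕ) (b : ι), 0 < (A ^ k) i₀ b → 0 < (A ^ (k + 1)) i₀ b := by
    intro k b h
    rw [pow_succ', mul_apply]
    exact Finset.sum_pos' (fun j _ => mul_nonneg (hA i₀ j) (pow_apply_nonneg hA k j b))
      ⟨i₀, Finset.mem_univ _, mul_pos hself h⟩
  have hex : ∀ b, ∃ m : ℕ, 0 < (A ^ m) i₀ b := by
    intro b
    induction hreach b using Relation.ReflTransGen.head_induction_on with
    | refl => exact ⟨0, by simp⟩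
    | head h _ ih => exact ih.imp' (· + 1) fun k hk => hmul k _ _ _ hk h
  choose m hm using hex
  refine ⟨Finset.univ.sup m, fun b => ?_⟩
  exact Nat.le_induction (hm b) (fun k _ hk => hmul' k b hk) _ (Finset.le_sup (Finset.mem_univ b))

end ColStochastic

section Augmented

variable {n : ℕ} {C : Matrix (Fin n) (Fin n) ℝ} {τ : Fin n → Fin n → ℕ} {τbar : ℕ}

theorem augmentedMatrix_apply_zero (r : Fin (τbar + 1)) (i j : Fin n) :
    augmentedMatrix C τ τbar (r, i) (0, j) = if τ i j = r then C i j else 0 := by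
  simp [augmentedMatrix, delaySlice]

theorem augmentedMatrix_apply_succ (a : Fin (τbar + 1) × Fin n) (s : Fin τbar) (j : Fin n) :
    augmentedMatrix C τ τbar a (s.succ, j) = if a = (s.castSucc, j) then 1 else 0 := by
  obtain ⟨r, i⟩ := a
  simp only [augmentedMatrix, of_apply, Fin.val_succ, Nat.add_eq_zero_iff, one_ne_zero, and_false,
    if_false, one_apply, Prod.mk.injEq, Fin.ext_iff, Fin.val_castSucc, Nat.add_right_cancel_iff]
  by_cases h : (s : ℕ) = r <;> by_cases h' : (i : ℕ) = j <;> simp [h, h', eq_comm]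

/-- Each nonzero weight `C i j` occurs exactly once in column `(0, j)`, in block row `τ i j`. -/
theorem augmentedMatrix_mem_colStochastic (hcol : C ∈ colStochastic ℝ (Fin n))
    (hτ : ∀ i j, C i j ≠ 0 → τ i j ≤ τbar) :
    augmentedMatrix C τ τbar ∈ colStochastic ℝ (Fin (τbar + 1) × Fin n) := by
  rw [mem_colStochastic_iff_sum]
  constructor
  · rintro ⟨r, i⟩ ⟨s, j⟩
    induction s using Fin.cases with
    | zero =>
      rw [augmentedMatrix_apply_zero]
      split_ifs
      exacts [nonneg_of_mem_colStochastic hcol, le_rfl]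
    | succ s =>
      rw [augmentedMatrix_apply_succ]
      split_ifs
      exacts [zero_le_one, le_rfl]
  · rintro ⟨s, j⟩
    induction s using Fin.cases with
    | zero =>
      rw [Fintype.sum_prod_type, Finset.sum_comm, ← sum_col_of_mem_colStochastic hcol j]
      refine Finset.sum_congr rfl fun i _ => ?_
      simp only [augmentedMatrix_apply_zero]
      by_cases hC : C i j = 0
      · simp [hC]
      · have hlt : τ i j < τbar + 1 := Nat.lt_succ_of_le (hτ i j hC)
        rw [Finset.sum_eq_single ⟨τ i j, hlt⟩]
        · simp
        · intro r _ hr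
          rw [if_neg]
          rintro h
          exact hr (Fin.ext h.symm)
        · simp
    | succ s => simp [augmentedMatrix_apply_succ]

/-- The identity blocks lower the delay index one step at a time. -/
theorem augmentedMatrix_reach_zero (r : Fin (τbar + 1)) (i : Fin n) :
    Relation.ReflTransGen (fun b a => 0 < augmentedMatrix C τ τbar a b) (r, i) (0, i) := by
  induction r using Fin.induction with
  | zero => exact .refl
  | succ r ih =>
    refine .head ?_ ih
    simp [augmentedMatrix_apply_succ]

theorem augmentedMatrix_reach_of_pos (hτ : ∀ i j, C i j ≠ 0 → τ i j ≤ τbar) {i j : Fin n}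
    (h : 0 < C i j) :
    Relation.ReflTransGen (fun b a => 0 < augmentedMatrix C τ τbar a b) (0, j) (0, i) := by
  refine .head ?_
    (augmentedMatrix_reach_zero ⟨τ i j, Nat.lt_succ_of_le (hτ i j h.ne')⟩ i)
  simpa [augmentedMatrix_apply_zero] using h

theorem augmentedMatrix_reach_of_pow_pos (hC : ∀ i j, 0 ≤ C i j)
    (hτ : ∀ i j, C i j ≠ 0 → τ i j ≤ τbar) (k : ℕ) {i j : Fin n} (h : 0 < (C ^ k) i j) :
    Relation.ReflTransGen (fun b a => 0 < augmentedMatrix C τ τbar a b) (0, j) (0, i) := by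
  induction k generalizing j with
  | zero =>
    obtain rfl : i = j := by
      by_contra hij
      simp [one_apply, hij] at h
    exact .refl
  | succ k ih =>
    rw [pow_succ, mul_apply] at h
    obtain ⟨l, -, hl⟩ := Finset.exists_lt_of_sum_lt (f := fun _ : Fin n => (0 : ℝ))
      (by simpa using h)
    have h₁ : 0 < (C ^ k) i l := pos_of_mul_pos_left hl (hC l j)
    have h₂ : 0 < C l j := pos_of_mul_pos_right hl (pow_apply_nonneg hC k i l)
    exact (augmentedMatrix_reach_of_pos hτ h₂).trans (ih h₁)

/-- The factor `I_p` decouples the `p` coordinates. -/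
theorem augmentedY_apply (p : ℕ) (y₀ : (Fin (τbar + 1) × Fin n) × Fin p → ℝ) (k : ℕ)
    (a : Fin (τbar + 1) × Fin n) (s : Fin p) :
    augmentedY C τ τbar p y₀ k (a, s) =
      ((augmentedMatrix C τ τbar ^ k) *ᵥ fun b => y₀ (b, s)) a := by
  induction k generalizing a with
  | zero => simp [augmentedY]
  | succ k ih =>
    rw [pow_succ', ← mulVec_mulVec, augmentedY, mulVec, mulVec, dotProduct, dotProduct,
      Fintype.sum_prod_type]
    refine Finset.sum_congr rfl fun b _ => ?_
    rw [← ih]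
    simp [one_apply]

end Augmented

theorem mainTheorem4 (n p τbar : ℕ)
    (C : Matrix (Fin n) (Fin n) ℝ) (hirr : C.IsIrreducible)
    (hcol : C ∈ Matrix.colStochastic ℝ (Fin n))
    (τ : Fin n → Fin n → ℕ) (hτ : ∀ i j, C i j ≠ 0 → τ i j ≤ τbar)
    (hself : ∃ i, 0 < C i i ∧ τ i i = 0)
    (y₀ : (Fin (τbar + 1) × Fin n) × Fin p → ℝ) (hy₀ : ∀ i s, y₀ ((0, i), s) = 1) :
    ∃ Yinf : Matrix ((Fin (τbar + 1) × Fin n) × Fin p) ((Fin (τbar + 1) × Fin n) × Fin p) ℝ,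
      Tendsto (diagY C τ τbar p y₀) atTop (𝓝 Yinf) ∧
      ∃ γ₁ T : ℝ, 0 < γ₁ ∧ γ₁ < 1 ∧ 0 < T ∧
        ∀ k : ℕ, ‖diagY C τ τbar p y₀ k - Yinf‖ ≤ T * γ₁ ^ k := by
  have hA := augmentedMatrix_mem_colStochastic (τbar := τbar) hcol hτ
  obtain ⟨l, hCl, hτl⟩ := hself
  have hC : ∀ i j, 0 ≤ C i j := fun i j => hcol.1 i j
  obtain ⟨N, hN⟩ := exists_pow_row_pos (i₀ := (0, l)) hA.1
    (by simpa [augmentedMatrix_apply_zero, hτl] using hCl) (fun b => by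
      obtain ⟨k, -, hk⟩ := (isIrreducible_iff_exists_pow_pos hC).1 hirr l b.2
      exact (augmentedMatrix_reach_zero b.1 b.2).trans
        (augmentedMatrix_reach_of_pow_pos hC hτ k hk))
  obtain ⟨γ, hγ0, hγ1, hγ⟩ := exists_geometric_bound_pow_mulVec hA hN
  set A := augmentedMatrix C τ τbar
  let y : Fin p → Fin (τbar + 1) × Fin n → ℝ := fun s b => y₀ (b, s)
  choose D hD0 hD using fun s => hγ (A *ᵥ y s - y s) (by
    simp [Finset.sum_sub_distrib, sum_mulVec_of_mem_colStochastic hA])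
  have hdist : ∀ k, dist (augmentedY C τ τbar p y₀ k) (augmentedY C τ τbar p y₀ (k + 1)) ≤
      (∑ s, D s) * γ ^ k := by
    intro k
    refine (dist_pi_le_iff (mul_nonneg (Finset.sum_nonneg fun s _ => hD0 s)
      (by positivity))).2 ?_
    rintro ⟨a, s⟩
    have h := hD s k a
    rw [mulVec_sub, mulVec_mulVec, ← pow_succ, Pi.sub_apply] at h
    rw [dist_comm, Real.dist_eq, augmentedY_apply, augmentedY_apply]
    refine h.trans ?_
    gcongr
    exact Finset.single_le_sum (fun s _ => hD0 s) (Finset.mem_univ s)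
  obtain ⟨L, hL⟩ := cauchySeq_tendsto_of_complete (cauchySeq_of_le_geometric γ _ hγ1 hdist)
  -- The `+ 1` keeps `T` positive even if every `D s` vanishes or `p = 0`.
  refine ⟨diagonal L, ?_, γ, (∑ s, D s) / (1 - γ) + 1, hγ0, hγ1, ?_, fun k => ?_⟩
  · exact ((continuous_id.matrix_diagonal).tendsto L).comp hL
  · have h0 : 0 ≤ ∑ s, D s := Finset.sum_nonneg fun s _ => hD0 s
    have h1 : 0 < 1 - γ := sub_pos.2 hγ1
    positivity
  · rw [diagY, diagonal_sub, l2_opNorm_diagonal]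
    change ‖augmentedY C τ τbar p y₀ k - L‖ ≤ _
    rw [← dist_eq_norm]
    refine (dist_le_of_le_geometric_of_tendsto γ _ hγ1 hdist hL k).trans ?_
    rw [add_mul, mul_div_right_comm]
    exact le_add_of_nonneg_right (by positivity)
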